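/- **Theorem (Modified-Hamiltonian stability of SNO).** Let $\mathbb P$ be a real Hilbert space with the symplectic form $\omega(u,v)=\langle Ju,v\rangle$, where $J$ is bounded, invertible and skew-adjoint. For a $C^1$ function $F$ write $X_F=J^{-1}\nabla F$ for its Hamiltonian vector field, $\mathcal L_FA=dA[X_F]$ for the Lie derivative of an observable $A$, and $\Phi_F^t$ for the flow of $X_F$. Let $\mathcal U\subset\mathbb P$ be open, let $\mathcal K\subset\mathcal U$ have compact closure contained in $\mathcal U$, let $m\ge 0$ be an integer, let $\tau>0$ and $\varepsilon_1>0$, and let $H\in C^{m+2}(\mathcal U;\mathbb R)$ be such that $\Phi_H^t$ is defined on $\mathcal U$ (with trajectories in $\mathcal U$) for $0\le t\le\tau$. For $0<\varepsilon<\varepsilon_1$ let $S_\varepsilon:\mathbb P\to\mathbb P$ be a (learned) map with the following properties. 1. (Hamiltonian perturbation representation.) On $\mathcal K$, $S_\varepsilon=\Phi^1_{K_\varepsilon}\circ\Phi^\tau_H$ (with trajectories in $\mathcal U$), where $K_\varepsilon=\sum_{j=1}^m\varepsilon^jK_j+r_\varepsilon$ on $\mathcal U$ with $K_j\in C^{m+2-j}(\mathcal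 U;\mathbb R)$, $r_\varepsilon\in C^{m+1}(\mathcal U;\mathbb R)$, and $r_\varepsilon=O(\varepsilon^{m+1})$ in $C^{m+1}$, locally uniformly on $\mathcal U$. 2. (Controlled BCH logarithm.) The pullback operator $A\mapsto A\circ S_\varepsilon=\exp(\tau\mathcal L_H)\exp(\mathcal L_{K_\varepsilon})A$ has a logarithm with a Hamiltonian expansion to order $m$. That is, there are $C^1$ functions $G_1,\dots,G_m:\mathcal U\to\mathbb R$ independent of $\varepsilon$, a constant $C_0$ independent of $\varepsilon$, and for each $\varepsilon\in(0,\varepsilon_1)$ a vector field $Z_\varepsilon$ on $\mathcal U$ (the operator $A\mapsto dA[Z_\varepsilon]$) such that every $u\in\mathcal K$ is joined to $S_\varepsilon(u)$ by a curve $\gamma:[0,1]\to\mathcal U$ with $\gamma(0)=u$, $\gamma(1)=S_\varepsilon(u)$ and, for all $s\in[0,1]$, $$\gamma'(s)=Z_\varepsilon(\gamma(s)),\qquad \bigl\|Z_\varepsilon(\gamma(s))-\tau X_{H+\varepsilon G_1+\cdots+\varepsilon^mG_m}(\gamma(s))\bigr\|\le C_0\,\varepsilon^{m+1}.$$ Then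 there are $C^1$ functions $H_1,\dots,H_m:\mathcal U\to\mathbb R$, independent of $\varepsilon$, and constants $C>0$ and $0<\varepsilon_0\le\varepsilon_1$, such that with the modified Hamiltonian $\widetilde H_\varepsilon=H+\varepsilon H_1+\cdots+\varepsilon^mH_m$ the following holds for every $\varepsilon\in(0,\varepsilon_0)$: $$\sup_{\mathcal K}|\widetilde H_\varepsilon-H|\le C\varepsilon,$$ and for every $N\ge 0$ and all $u_0,\dots,u_N\in\mathcal K$ with $u_{n+1}=S_\varepsilon(u_n)$ for $0\le n<N$, and every $0\le n\le N$, $$|\widetilde H_\varepsilon(u_n)-\widetilde H_\varepsilon(u_0)|\le C\,n\,\varepsilon^{m+1},\qquad |H(u_n)-H(u_0)|\le C\varepsilon+C\,n\,\varepsilon^{m+1}.$$ In particular, for every $c>0$ there is $C'>0$, independent of $\varepsilon$, $N$, $n$ and the rollout, such that $|H(u_n)-H(u_0)|\le C'\varepsilon$ for all $\varepsilon\in(0,\varepsilon_0)$ and all such rollouts whenever $0\le n\le N$ and $n\le c\,\varepsilon^{-m}$. -/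

import Mathlib

open Set

noncomputable section

variable {P : Type*} [NormedAddCommGroup P] [InnerProductSpace ℝ P] [CompleteSpace P]

/-- The bounded invertible operator `J` is skew-adjoint, so that `ω(u, v) = ⟪J u, v⟫` is a
(strong, constant) symplectic form on the Hilbert space `P`. -/
def IsSkewAdjoint (J : P ≃L[ℝ] P) : Prop :=
  ∀ u v : P, inner ℝ (J u) v = -inner ℝ u (J v)

/-- The Hamiltonian vector field `X_F = J⁻¹ ∇F`, i.e. `ω(X_F(x), v) = dF(x)[v]` for all `v`. The
Lie derivative of an observable `A` along it is `(L_F A)(x) = dA(x)[X_F(x)]`. -/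
def hamVec (J : P ≃L[ℝ] P) (F : P → ℝ) (x : P) : P :=
  J.symm (gradient F x)

/-- `γ` solves `γ' = X(γ)` on `[0, T]` and stays in `U` (one-sided derivatives at the ends). -/
def IsSolutionOn (U : Set P) (X : P → P) (T : ℝ) (γ : ℝ → P) : Prop :=
  ∀ s ∈ Icc (0 : ℝ) T, γ s ∈ U ∧ HasDerivWithinAt γ (X (γ s)) (Icc (0 : ℝ) T) s

/-- `Φ_X^T(x) = y`: the solution in `U` of `γ' = X(γ)` that starts at `x` is at `y` at time `T`. -/
def FlowsTo (U : Set P) (X : P → P) (T : ℝ) (x y : P) : Prop :=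
  ∃ γ : ℝ → P, IsSolutionOn U X T γ ∧ γ 0 = x ∧ γ T = y

/-- The polynomial `∑_{j=1}^m ε^j F_j` in `ε` with function coefficients. -/
def epsSum (m : ℕ) (F : ℕ → P → ℝ) (ε : ℝ) (x : P) : ℝ :=
  ∑ j ∈ Finset.Icc 1 m, ε ^ j * F j x

/-- The modified Hamiltonian `H + ε H_1 + ⋯ + ε^m H_m`. -/
def modifiedHam (m : ℕ) (H : P → ℝ) (Hc : ℕ → P → ℝ) (ε : ℝ) (x : P) : ℝ :=
  H x + epsSum m Hc ε x

/-- `K_ε = ∑_{j=1}^m ε^j K_j + O(ε^{m+1})` for `0 < ε < ε₁`, with `K_j ∈ C^{m+2-j}(U)` and the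
remainder measured in `C^{m+1}`, locally uniformly on the open set `U`. -/
def HasEpsExpansion (U : Set P) (m : ℕ) (ε₁ : ℝ) (Kε : ℝ → P → ℝ) (Kc : ℕ → P → ℝ) : Prop :=
  (∀ j ∈ Finset.Icc 1 m, ContDiffOn ℝ ((m + 2 - j : ℕ) : ℕ∞) (Kc j) U) ∧
  (∀ ε ∈ Ioo (0 : ℝ) ε₁,
    ContDiffOn ℝ ((m + 1 : ℕ) : ℕ∞) (fun x => Kε ε x - epsSum m Kc ε x) U) ∧
  ∀ x ∈ U, ∃ V ∈ nhds x, ∃ C : ℝ, ∀ ε ∈ Ioo (0 : ℝ) ε₁, ∀ y ∈ V ∩ U, ∀ k ≤ m + 1,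
    ‖iteratedFDeriv ℝ k (fun z => Kε ε z - epsSum m Kc ε z) y‖ ≤ C * ε ^ (m + 1)

/-- `S = Φ_K^1 ∘ Φ_H^τ` on `R`. Pulling back observables, `A ∘ S = exp(τ L_H) exp(L_K) A`. -/
def IsPerturbedFlowMap (J : P ≃L[ℝ] P) (U R : Set P) (τ : ℝ) (H K : P → ℝ) (S : P → P) : Prop :=
  ∀ u ∈ R, ∃ v : P, FlowsTo U (hamVec J H) τ u v ∧ FlowsTo U (hamVec J K) 1 v (S u)

/-- The logarithm of the pullback operators `A ↦ A ∘ S_ε` has a Hamiltonian expansion with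
coefficients `H, H_1, …, H_m`. The logarithm is a vector field `Z_ε` on `U` (acting on observables
as `A ↦ dA[Z_ε]`) whose exponential, i.e. its time-one map, is `S_ε` on `R`; and
`Z_ε = τ X_{H + ε H_1 + ⋯ + ε^m H_m} + O(ε^{m+1})`, uniformly over the starting points `u ∈ R`
along the curves `s ↦ exp(s Z_ε)(u)`, `0 ≤ s ≤ 1`. -/
def HasHamiltonianLog (J : P ≃L[ℝ] P) (U R : Set P) (m : ℕ) (τ ε₁ : ℝ) (H : P → ℝ)
    (S : ℝ → P → P) (Hc : ℕ → P → ℝ) : Prop :=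
  (∀ j ∈ Finset.Icc 1 m, ContDiffOn ℝ 1 (Hc j) U) ∧
  ∃ (Z : ℝ → P → P) (C : ℝ), ∀ ε ∈ Ioo (0 : ℝ) ε₁, ∀ u ∈ R,
    ∃ γ : ℝ → P, IsSolutionOn U (Z ε) 1 γ ∧ γ 0 = u ∧ γ 1 = S ε u ∧
      ∀ s ∈ Icc (0 : ℝ) 1,
        ‖Z ε (γ s) - τ • hamVec J (modifiedHam m H Hc ε) (γ s)‖ ≤ C * ε ^ (m + 1)

/-- `u_0, …, u_N` is a rollout of the map `S` that stays in `R`. -/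
def IsRollout (R : Set P) (S : P → P) (N : ℕ) (u : ℕ → P) : Prop :=
  (∀ n < N, u (n + 1) = S (u n)) ∧ ∀ n ≤ N, u n ∈ R

end

/-! Along its own Hamiltonian field a modified Hamiltonian `F` is constant, since `⟪∇F, J⁻¹∇F⟫ = 0`.
The logarithm `Z_ε` equals `τ X_F` up to `O(ε^(m+1))`, so along the curve from `u` to `S_ε(u)` the
derivative `⟪∇F, Z_ε⟫` sees only this defect. One step therefore costs `O(ε^(m+1))` provided `∇F` is
bounded along the curve.

That bound is the real issue: the curves lie in `U` but in no prescribed compact set. Each `x` in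
the compact closure has an `H`-trajectory over `[0, τ]`, with compact image. A Gronwall argument
keeps the curves starting near `x` in a tube around it, where the gradients are bounded
(`exists_tube_bounds`, `norm_sub_lt_of_tube`, `exists_local_energy_error`). Compactness makes the
constants uniform, and the step errors add up along a rollout. -/

/-! ### Gradients and sums in powers of `ε` -/

/-- A `C^k` function on an open set has a `C^n` gradient at each of its points when `n + 1 ≤ k`. -/
theorem contDiffAt_gradient {P : Type*} [NormedAddCommGroup P] [InnerProductSpace ℝ P]
    [CompleteSpace P] {U : Set P} (hU : IsOpen U) {F : P → ℝ} {n k : WithTop ℕ∞}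
    (hF : ContDiffOn ℝ k F U) (hk : n + 1 ≤ k) {x : P} (hx : x ∈ U) :
    ContDiffAt ℝ n (gradient F) x :=
  (InnerProductSpace.toDual ℝ P).symm.toContinuousLinearEquiv.contDiff.contDiffAt.comp x
    ((hF.contDiffAt (hU.mem_nhds hx)).fderiv_right hk)

theorem hasGradientAt_of_contDiffOn_one {P : Type*} [NormedAddCommGroup P] [InnerProductSpace ℝ P]
    [CompleteSpace P] {U : Set P} (hU : IsOpen U) {F : P → ℝ} {k : WithTop ℕ∞}
    (hF : ContDiffOn ℝ k F U) (hk : k ≠ 0) {x : P} (hx : x ∈ U) :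
    HasGradientAt F (gradient F x) x :=
  ((hF.contDiffAt (hU.mem_nhds hx)).differentiableAt hk).hasGradientAt

/-- The Hamiltonian vector field is orthogonal to the gradient: energy is conserved. -/
theorem inner_symm_self_of_isSkewAdjoint {P : Type*} [NormedAddCommGroup P]
    [InnerProductSpace ℝ P] {J : P ≃L[ℝ] P} (hJ : IsSkewAdjoint J) (g : P) :
    inner ℝ g (J.symm g) = 0 := by
  have h := hJ (J.symm g) (J.symm g)
  rw [J.apply_symm_apply] at h
  linarith [real_inner_comm g (J.symm g)]

theorem hasGradientAt_modifiedHam {P : Type*} [NormedAddCommGroup P] [InnerProductSpace ℝ P]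
    [CompleteSpace P] {m : ℕ} {H : P → ℝ} {G : ℕ → P → ℝ} {ε : ℝ} {x g : P} {g' : ℕ → P}
    (hH : HasGradientAt H g x) (hG : ∀ j ∈ Finset.Icc 1 m, HasGradientAt (G j) (g' j) x) :
    HasGradientAt (modifiedHam m H G ε) (g + ∑ j ∈ Finset.Icc 1 m, ε ^ j • g' j) x := by
  rw [hasGradientAt_iff_hasFDerivAt] at hH ⊢
  have h : HasFDerivAt (fun y => ∑ j ∈ Finset.Icc 1 m, ε ^ j * G j y)
      (∑ j ∈ Finset.Icc 1 m, ε ^ j • InnerProductSpace.toDual ℝ P (g' j)) x :=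
    HasFDerivAt.fun_sum fun j hj =>
      (hasGradientAt_iff_hasFDerivAt.mp (hG j hj)).const_mul (ε ^ j)
  rw [map_add, map_sum]
  simp only [map_smul]
  exact hH.add h

/-- The sum starts at `j = 1` and `ε ≤ 1`, so each of the `m` powers is at most `ε`. -/
theorem sum_Icc_pow_mul_le {m : ℕ} {ε L : ℝ} (hε : 0 ≤ ε) (hε1 : ε ≤ 1) (hL : 0 ≤ L)
    {a : ℕ → ℝ} (ha : ∀ j ∈ Finset.Icc 1 m, a j ≤ L) :
    ∑ j ∈ Finset.Icc 1 m, ε ^ j * a j ≤ m * L * ε := by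
  have h : ∀ j ∈ Finset.Icc 1 m, ε ^ j * a j ≤ ε * L := fun j hj =>
    calc ε ^ j * a j ≤ ε ^ j * L := by gcongr; exact ha j hj
      _ ≤ ε * L := by
        gcongr
        exact pow_le_of_le_one hε hε1 (by have := (Finset.mem_Icc.mp hj).1; omega)
  refine (Finset.sum_le_sum h).trans (le_of_eq ?_)
  simp only [Finset.sum_const, Nat.card_Icc, nsmul_eq_mul, Nat.add_sub_cancel]
  ring

theorem norm_sum_Icc_pow_smul_le {E : Type*} [SeminormedAddCommGroup E] [NormedSpace ℝ E]
    {m : ℕ} {ε L : ℝ} (hε : 0 ≤ ε) (hε1 : ε ≤ 1) (hL : 0 ≤ L)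
    {v : ℕ → E} (hv : ∀ j ∈ Finset.Icc 1 m, ‖v j‖ ≤ L) :
    ‖∑ j ∈ Finset.Icc 1 m, ε ^ j • v j‖ ≤ m * L * ε := by
  refine (norm_sum_le _ _).trans ?_
  simp only [norm_smul, norm_pow, Real.norm_of_nonneg hε]
  exact sum_Icc_pow_mul_le hε hε1 hL hv

/-! ### Tubes around compact sets -/

open Topology in
/-- Around a compact set there is a uniform tube on which a locally Lipschitz map is bounded and
Lipschitz relative to the core, and finitely many continuous maps are bounded. -/
theorem exists_tube_bounds {E F : Type*} [NormedAddCommGroup E] [NormedAddCommGroup F]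
    {T : Set E} (hT : IsCompact T) {X : E → F} {g : ℕ → E → F} (s : Finset ℕ)
    (hX : ∀ x ∈ T, ∃ K : NNReal, ∃ V ∈ 𝓝 x, LipschitzOnWith K X V)
    (hg : ∀ j ∈ s, ∀ x ∈ T, ContinuousAt (g j) x) :
    ∃ r > 0, ∃ L ≥ 0, ∀ p ∈ T, ∀ y, ‖y - p‖ < r →
      ‖X y - X p‖ ≤ L * ‖y - p‖ ∧ ‖X y‖ ≤ L ∧ ∀ j ∈ s, ‖g j y‖ ≤ L := by
  refine hT.induction_on (p := fun T => ∃ r > 0, ∃ L ≥ 0, ∀ p ∈ T, ∀ y, ‖y - p‖ < r →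
      ‖X y - X p‖ ≤ L * ‖y - p‖ ∧ ‖X y‖ ≤ L ∧ ∀ j ∈ s, ‖g j y‖ ≤ L) ?_ ?_ ?_ ?_
  · exact ⟨1, one_pos, 0, le_rfl, by simp⟩
  · rintro A B hAB ⟨r, hr, L, hL, h⟩
    exact ⟨r, hr, L, hL, fun p hp => h p (hAB hp)⟩
  · rintro A B ⟨r, hr, L, hL, h⟩ ⟨r', hr', L', hL', h'⟩
    refine ⟨min r r', lt_min hr hr', max L L', le_max_of_le_left hL, fun p hp y hy => ?_⟩
    rcases hp with hp | hp
    · obtain ⟨h1, h2, h3⟩ := h p hp y (hy.trans_le (min_le_left _ _))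
      exact ⟨h1.trans (by gcongr; exact le_max_left _ _), h2.trans (le_max_left _ _),
        fun j hj => (h3 j hj).trans (le_max_left _ _)⟩
    · obtain ⟨h1, h2, h3⟩ := h' p hp y (hy.trans_le (min_le_right _ _))
      exact ⟨h1.trans (by gcongr; exact le_max_right _ _), h2.trans (le_max_right _ _),
        fun j hj => (h3 j hj).trans (le_max_right _ _)⟩
  · intro x hx
    obtain ⟨K, V, hV, hK⟩ := hX x hx
    have hgx : ∀ᶠ y in 𝓝 x, ∀ j ∈ s, ‖g j y‖ ≤ ‖g j x‖ + 1 := by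
      rw [Filter.eventually_all_finset]
      intro j hj
      filter_upwards [(hg j hj x hx).norm.eventually_lt_const (lt_add_one ‖g j x‖)] with y hy
      exact hy.le
    have hXx : ∀ᶠ y in 𝓝 x, ‖X y‖ ≤ ‖X x‖ + 1 := by
      have hc : ContinuousAt X x := hK.continuousOn.continuousAt hV
      filter_upwards [hc.norm.eventually_lt_const (lt_add_one ‖X x‖)] with y hy
      exact hy.le
    obtain ⟨ρ, hρ, hb⟩ := Metric.eventually_nhds_iff.mp ((hgx.and hXx).and hV)
    set M : ℝ := ∑ j ∈ s, ‖g j x‖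
    have hM : ∀ j ∈ s, ‖g j x‖ ≤ M := fun j hj =>
      Finset.single_le_sum (f := fun j => ‖g j x‖) (fun _ _ => norm_nonneg _) hj
    have hM0 : 0 ≤ M := Finset.sum_nonneg fun _ _ => norm_nonneg _
    -- Halving `ρ` puts both `p` and any `y` within `ρ / 2` of `p` inside the `ρ`-ball of `x`, where
    -- all the local bounds hold.
    refine ⟨Metric.ball x (ρ / 2), mem_nhdsWithin_of_mem_nhds (Metric.ball_mem_nhds x (half_pos hρ)),
      ρ / 2, half_pos hρ, K + (‖X x‖ + 1) + M, by positivity, fun p hp y hy => ?_⟩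
    have hpx : dist p x < ρ / 2 := hp
    have hyp : dist y p < ρ / 2 := by rwa [dist_eq_norm]
    obtain ⟨⟨h1, h2⟩, h3⟩ := hb (show dist y x < ρ by linarith [dist_triangle y p x])
    have h4 : p ∈ V := (hb (show dist p x < ρ by linarith)).2
    have hX0 := norm_nonneg (X x)
    refine ⟨?_, ?_, fun j hj => ?_⟩
    · have := hK.dist_le_mul y h3 p h4
      rw [dist_eq_norm, dist_eq_norm] at this
      refine this.trans ?_
      gcongr
      linarith
    · linarith [K.coe_nonneg]
    · linarith [h1 j hj, hM j hj, K.coe_nonneg]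

/-- A curve whose velocity differs from that of a reference curve by at most `a * distance + b`, as
long as the distance stays below `r`, does not leave the `r`-tube during unit time if it starts
close enough and `b` is small enough. -/
theorem norm_sub_lt_of_tube {E : Type*} [NormedAddCommGroup E] [NormedSpace ℝ E]
    {f f' : ℝ → E} {a b r : ℝ} (hr : 0 < r) (ha : 0 ≤ a)
    (hb : b < r / 2 * Real.exp (-(a + 1)))
    (hf : ∀ s ∈ Icc (0 : ℝ) 1, HasDerivWithinAt f (f' s) (Icc 0 1) s)
    (h0 : ‖f 0‖ ≤ r / 2 * Real.exp (-(a + 1)))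
    (hf' : ∀ s ∈ Icc (0 : ℝ) 1, ‖f s‖ < r → ‖f' s‖ ≤ a * ‖f s‖ + b) :
    ∀ s ∈ Icc (0 : ℝ) 1, ‖f s‖ < r := by
  set η := r / 2 * Real.exp (-(a + 1)) with hη
  have hη0 : 0 < η := by positivity
  have hB1 : ∀ s ∈ Icc (0 : ℝ) 1, η * Real.exp ((a + 1) * s) < r := by
    intro s hs
    have : Real.exp (-(a + 1)) * Real.exp ((a + 1) * s) ≤ 1 := by
      rw [← Real.exp_add, Real.exp_le_one_iff]
      nlinarith [hs.2]
    rw [hη, mul_assoc]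
    nlinarith
  have hB2 : ∀ s ∈ Icc (0 : ℝ) 1, η ≤ η * Real.exp ((a + 1) * s) := fun s hs =>
    le_mul_of_one_le_right hη0.le (Real.one_le_exp (mul_nonneg (by linarith) hs.1))
  -- The barrier `η * exp ((a + 1) * s)` grows at rate `a + 1` rather than `a`. Where `‖f‖` touches
  -- it, the velocity is at most `a * barrier + b`, strictly less than the barrier's slope because
  -- `b < η ≤ barrier`.
  have key : ∀ ⦃s⦄, s ∈ Icc (0 : ℝ) 1 → ‖f s‖ ≤ η * Real.exp ((a + 1) * s) := by
    refine image_norm_le_of_norm_deriv_right_lt_deriv_boundary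
      (f' := f') (B' := fun s => (a + 1) * (η * Real.exp ((a + 1) * s)))
      (fun s hs => (hf s hs).continuousWithinAt)
      (fun s hs => (hf s (Ico_subset_Icc_self hs)).mono_of_mem_nhdsWithin
        (Icc_mem_nhdsGE_of_mem hs)) (by simpa using h0) (fun s => ?_) (fun s hs hfs => ?_)
    · have h1 : HasDerivAt (fun s : ℝ => (a + 1) * s) (a + 1) s := by
        simpa using (hasDerivAt_id s).const_mul (a + 1)
      exact (h1.exp.const_mul η).congr_deriv (by ring)
    · have hs' := Ico_subset_Icc_self hs
      have h1 := hf' s hs' (hfs ▸ hB1 s hs')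
      rw [hfs] at h1
      linarith [hB2 s hs']
  exact fun s hs => (key hs).trans_lt (hB1 s hs)

/-! ### Energy error of one step -/

/-- Near a point whose Hamiltonian trajectory exists up to time `τ`, one step of the map changes
the modified Hamiltonian by `O(ε ^ (m + 1))`, uniformly for small `ε`. -/
theorem exists_local_energy_error {P : Type*} [NormedAddCommGroup P] [InnerProductSpace ℝ P]
    [CompleteSpace P] {J : P ≃L[ℝ] P} (hJ : IsSkewAdjoint J) {U R : Set P} (hU : IsOpen U)
    {m : ℕ} {τ : ℝ} (hτ : 0 < τ) {H : P → ℝ} (hH : ContDiffOn ℝ 2 H U)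
    {G : ℕ → P → ℝ} (hG : ∀ j ∈ Finset.Icc 1 m, ContDiffOn ℝ 1 (G j) U)
    {x y : P} (hxy : FlowsTo U (hamVec J H) τ x y)
    {ε₁ : ℝ} {S : ℝ → P → P} {Z : ℝ → P → P} {C : ℝ} (hC : 0 ≤ C)
    (hZ : ∀ ε ∈ Ioo (0 : ℝ) ε₁, ∀ u ∈ R,
      ∃ γ : ℝ → P, IsSolutionOn U (Z ε) 1 γ ∧ γ 0 = u ∧ γ 1 = S ε u ∧
        ∀ s ∈ Icc (0 : ℝ) 1,
          ‖Z ε (γ s) - τ • hamVec J (modifiedHam m H G ε) (γ s)‖ ≤ C * ε ^ (m + 1)) :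
    ∃ η > 0, ∃ δ > 0, ∃ D ≥ 0, ∀ ε ∈ Ioo (0 : ℝ) ε₁, ε < δ → ∀ u ∈ R, ‖u - x‖ < η →
      |modifiedHam m H G ε (S ε u) - modifiedHam m H G ε u| ≤ D * ε ^ (m + 1) := by
  obtain ⟨q, hq, rfl, -⟩ := hxy
  have hqc : ContinuousOn q (Icc 0 τ) := fun s hs => (hq s hs).2.continuousWithinAt
  have hTU : ∀ p ∈ q '' Icc 0 τ, p ∈ U := by
    rintro _ ⟨s, hs, rfl⟩
    exact (hq s hs).1
  -- `H` is `C^2`, so its gradient is locally Lipschitz, as Gronwall needs; the `C^1` functions `G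
  -- j` enter with a factor `ε`, so bounded gradients suffice.
  obtain ⟨r, hr, L, hL, htube⟩ := exists_tube_bounds (isCompact_Icc.image_of_continuousOn hqc)
    (X := gradient H) (g := fun j => gradient (G j)) (Finset.Icc 1 m)
    (fun p hp => (contDiffAt_gradient hU hH (n := 1) (by norm_num)
      (hTU p hp)).exists_lipschitzOnWith)
    (fun j hj p hp => (contDiffAt_gradient hU (hG j hj) (n := 0) (by norm_num)
      (hTU p hp)).continuousAt)
  set κ : ℝ := ‖(J.symm : P →L[ℝ] P)‖ with hκ
  have hκ0 : 0 ≤ κ := norm_nonneg _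
  have hJle : ∀ v, ‖J.symm v‖ ≤ κ * ‖v‖ := (J.symm : P →L[ℝ] P).le_opNorm
  set a : ℝ := τ * κ * L with ha
  have ha0 : 0 ≤ a := by positivity
  set η : ℝ := r / 2 * Real.exp (-(a + 1)) with hη
  have hη0 : 0 < η := by positivity
  have hCm : 0 < C + a * m + 1 := by positivity
  -- The second bound on `ε` gives `(C + a * m) * ε < η`, the smallness of the forcing needed to
  -- stay in the tube. In the error constant, `L + m * L` bounds the gradient and `C` the defect of
  -- `Z ε`.
  refine ⟨η, hη0, min 1 (η / (C + a * m + 1)), lt_min one_pos (by positivity),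
    (L + m * L) * C, by positivity, fun ε hε hεδ u hu hux => ?_⟩
  have hε0 := hε.1
  have hε1 : ε ≤ 1 := (hεδ.trans_le (min_le_left _ _)).le
  have hεη : ε * (C + a * m + 1) < η :=
    (lt_div_iff₀ hCm).mp (hεδ.trans_le (min_le_right _ _))
  have hεm : ε ^ (m + 1) ≤ ε := pow_le_of_le_one hε0.le hε1 (by omega)
  obtain ⟨γ, hγ, rfl, hγ1, hZγ⟩ := hZ ε hε u hu
  have hgrad : ∀ s ∈ Icc (0 : ℝ) 1, HasGradientAt (modifiedHam m H G ε)
      (gradient H (γ s) + ∑ j ∈ Finset.Icc 1 m, ε ^ j • gradient (G j) (γ s)) (γ s) :=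
    fun s hs => hasGradientAt_modifiedHam
      (hasGradientAt_of_contDiffOn_one hU hH (by norm_num) (hγ s hs).1)
      (fun j hj => hasGradientAt_of_contDiffOn_one hU (hG j hj) (by norm_num) (hγ s hs).1)
  have hτs : ∀ s ∈ Icc (0 : ℝ) 1, τ * s ∈ Icc 0 τ := fun s hs =>
    ⟨mul_nonneg hτ.le hs.1, mul_le_of_le_one_right hτ.le hs.2⟩
  -- The reference trajectory starts at `x`, not at `u`, and is rescaled to unit time.
  have hnear : ∀ s ∈ Icc (0 : ℝ) 1, ‖γ s - q (τ * s)‖ < r := by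
    refine norm_sub_lt_of_tube (f := fun s => γ s - q (τ * s))
      (f' := fun s => Z ε (γ s) - τ • hamVec J H (q (τ * s))) (a := a) (b := (C + a * m) * ε)
      hr ha0 (by linarith) (fun s hs => (hγ s hs).2.sub ?_) (by simp only [mul_zero]; exact hux.le)
      (fun s hs hs' => ?_)
    · have h1 : HasDerivWithinAt (fun s : ℝ => τ * s) τ (Icc 0 1) s := by
        simpa using ((hasDerivAt_id s).const_mul τ).hasDerivWithinAt
      exact (hq _ (hτs s hs)).2.scomp s h1 hτs
    · obtain ⟨h1, -, h3⟩ := htube _ (mem_image_of_mem q (hτs s hs)) _ hs'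
      have h4 := norm_sum_Icc_pow_smul_le hε0.le hε1 hL h3
      have h5 := hZγ s hs
      have h6 : Z ε (γ s) - τ • hamVec J H (q (τ * s)) =
          (Z ε (γ s) - τ • hamVec J (modifiedHam m H G ε) (γ s)) +
          τ • J.symm ((gradient H (γ s) - gradient H (q (τ * s))) +
            ∑ j ∈ Finset.Icc 1 m, ε ^ j • gradient (G j) (γ s)) := by
        rw [hamVec, hamVec, (hgrad s hs).gradient]
        simp only [map_add, map_sub, smul_add, smul_sub]
        abel
      rw [h6]
      refine (norm_add_le _ _).trans ?_
      rw [norm_smul, Real.norm_of_nonneg hτ.le]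
      calc _ ≤ C * ε ^ (m + 1) + τ * (κ * (L * ‖γ s - q (τ * s)‖ + m * L * ε)) := by
            gcongr
            exact (hJle _).trans
              (mul_le_mul_of_nonneg_left ((norm_add_le _ _).trans (add_le_add h1 h4)) hκ0)
        _ ≤ C * ε + τ * (κ * (L * ‖γ s - q (τ * s)‖ + m * L * ε)) := by gcongr
        _ = _ := by rw [ha]; ring
  have hderiv : ∀ s ∈ Icc (0 : ℝ) 1,
      HasDerivWithinAt (fun s => modifiedHam m H G ε (γ s))
        (inner ℝ (gradient (modifiedHam m H G ε) (γ s)) (Z ε (γ s))) (Icc 0 1) s := by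
    intro s hs
    have h := hgrad s hs
    rw [h.gradient]
    exact (hasGradientAt_iff_hasFDerivAt.mp h).comp_hasDerivWithinAt s (hγ s hs).2
  have hbound : ∀ s ∈ Icc (0 : ℝ) 1,
      ‖(inner ℝ (gradient (modifiedHam m H G ε) (γ s)) (Z ε (γ s)) : ℝ)‖ ≤
        (L + m * L) * C * ε ^ (m + 1) := by
    intro s hs
    set v := gradient (modifiedHam m H G ε) (γ s) with hv
    -- Subtracting `τ X` is free, because `X` is orthogonal to `v`.
    have h0 : (inner ℝ v (Z ε (γ s)) : ℝ) =
        inner ℝ v (Z ε (γ s) - τ • hamVec J (modifiedHam m H G ε) (γ s)) := by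
      rw [inner_sub_right, inner_smul_right, hamVec, inner_symm_self_of_isSkewAdjoint hJ]
      ring
    have hvL : ‖v‖ ≤ L + m * L := by
      rw [hv, (hgrad s hs).gradient]
      obtain ⟨-, h2, h3⟩ := htube _ (mem_image_of_mem q (hτs s hs)) _ (hnear s hs)
      have h4 := norm_sum_Icc_pow_smul_le hε0.le hε1 hL h3
      refine (norm_add_le _ _).trans (add_le_add h2 (h4.trans ?_))
      exact mul_le_of_le_one_right (by positivity) hε1
    rw [h0, mul_assoc]
    exact (norm_inner_le_norm _ _).trans
      (mul_le_mul hvL (hZγ s hs) (norm_nonneg _) (by positivity))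
  have h := (convex_Icc (0 : ℝ) 1).norm_image_sub_le_of_norm_hasDerivWithin_le hderiv hbound
    (left_mem_Icc.mpr zero_le_one) (right_mem_Icc.mpr zero_le_one)
  rw [hγ1] at h
  simpa using h

/-- The one-step error of the modified Hamiltonian is `O(ε ^ (m + 1))` uniformly on a relatively
compact set. -/
theorem exists_uniform_energy_error {P : Type*} [NormedAddCommGroup P] [InnerProductSpace ℝ P]
    [CompleteSpace P] {J : P ≃L[ℝ] P} (hJ : IsSkewAdjoint J) {U R : Set P} (hU : IsOpen U)
    (hRc : IsCompact (closure R)) (hRU : closure R ⊆ U)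
    {m : ℕ} {τ : ℝ} (hτ : 0 < τ) {H : P → ℝ} (hH : ContDiffOn ℝ 2 H U)
    (hflow : ∀ x ∈ U, ∃ y, FlowsTo U (hamVec J H) τ x y)
    {ε₁ : ℝ} {S : ℝ → P → P} {G : ℕ → P → ℝ} (hlog : HasHamiltonianLog J U R m τ ε₁ H S G) :
    ∃ δ > 0, ∃ D ≥ 0, ∀ ε ∈ Ioo (0 : ℝ) ε₁, ε < δ → ∀ u ∈ R,
      |modifiedHam m H G ε (S ε u) - modifiedHam m H G ε u| ≤ D * ε ^ (m + 1) := by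
  obtain ⟨hG, Z, C, hZ⟩ := hlog
  -- The extra condition `u ∈ closure R` supplies the set variable for the compactness induction.
  suffices h : ∃ δ > 0, ∃ D ≥ 0, ∀ ε ∈ Ioo (0 : ℝ) ε₁, ε < δ → ∀ u ∈ R, u ∈ closure R →
      |modifiedHam m H G ε (S ε u) - modifiedHam m H G ε u| ≤ D * ε ^ (m + 1) by
    obtain ⟨δ, hδ, D, hD, h⟩ := h
    exact ⟨δ, hδ, D, hD, fun ε hε hεδ u hu => h ε hε hεδ u hu (subset_closure hu)⟩
  refine hRc.induction_on (p := fun T => ∃ δ > 0, ∃ D ≥ 0, ∀ ε ∈ Ioo (0 : ℝ) ε₁, ε < δ → ∀ u ∈ R,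
    u ∈ T → |modifiedHam m H G ε (S ε u) - modifiedHam m H G ε u| ≤ D * ε ^ (m + 1)) ?_ ?_ ?_ ?_
  · exact ⟨1, one_pos, 0, le_rfl, by simp⟩
  · rintro A B hAB ⟨δ, hδ, D, hD, h⟩
    exact ⟨δ, hδ, D, hD, fun ε hε hεδ u hu huA => h ε hε hεδ u hu (hAB huA)⟩
  · rintro A B ⟨δ, hδ, D, hD, h⟩ ⟨δ', hδ', D', hD', h'⟩
    refine ⟨min δ δ', lt_min hδ hδ', D + D', add_nonneg hD hD', fun ε hε hεδ u hu huAB => ?_⟩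
    have hpos := pow_pos hε.1 (m + 1)
    rcases huAB with hu' | hu'
    · have := h ε hε (hεδ.trans_le (min_le_left _ _)) u hu hu'
      nlinarith
    · have := h' ε hε (hεδ.trans_le (min_le_right _ _)) u hu hu'
      nlinarith
  · intro x hx
    obtain ⟨y, hxy⟩ := hflow x (hRU hx)
    obtain ⟨η, hη, δ, hδ, D, hD, h⟩ := exists_local_energy_error hJ hU hτ hH hG hxy
      (R := R) (S := S) (Z := Z) (abs_nonneg C) (fun ε hε u hu => by
        obtain ⟨γ, h1, h2, h3, h4⟩ := hZ ε hε u hu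
        refine ⟨γ, h1, h2, h3, fun s hs => (h4 s hs).trans ?_⟩
        have := pow_pos hε.1 (m + 1)
        gcongr
        exact le_abs_self C)
    refine ⟨Metric.ball x η, mem_nhdsWithin_of_mem_nhds (Metric.ball_mem_nhds x hη), δ, hδ, D, hD,
      fun ε hε hεδ u hu hux => h ε hε hεδ u hu ?_⟩
    rwa [Metric.mem_ball, dist_eq_norm] at hux

/-- On a relatively compact set the modified Hamiltonian is `O(ε)`-close to the original one. -/
theorem exists_abs_modifiedHam_sub_le {P : Type*} [NormedAddCommGroup P] {R : Set P}
    (hRc : IsCompact (closure R)) {m : ℕ} (H : P → ℝ) {G : ℕ → P → ℝ}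
    (hG : ∀ j ∈ Finset.Icc 1 m, ContinuousOn (G j) (closure R)) :
    ∃ B ≥ 0, ∀ ε, 0 ≤ ε → ε ≤ 1 → ∀ x ∈ R, |modifiedHam m H G ε x - H x| ≤ B * ε := by
  -- Stated for all `j`, with a dummy bound off the index set, so that `choose` yields a plain
  -- sequence `b`.
  have h : ∀ j, ∃ b, j ∈ Finset.Icc 1 m → ∀ x ∈ closure R, ‖G j x‖ ≤ b := fun j => by
    by_cases hj : j ∈ Finset.Icc 1 m
    · obtain ⟨b, hb⟩ := hRc.exists_bound_of_continuousOn (hG j hj)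
      exact ⟨b, fun _ => hb⟩
    · exact ⟨0, fun h => absurd h hj⟩
  choose b hb using h
  set L : ℝ := ∑ j ∈ Finset.Icc 1 m, |b j|
  have hL : 0 ≤ L := Finset.sum_nonneg fun _ _ => abs_nonneg _
  refine ⟨m * L, by positivity, fun ε hε hε1 x hx => ?_⟩
  rw [modifiedHam, add_sub_cancel_left, epsSum]
  refine norm_sum_Icc_pow_smul_le (v := fun j => G j x) hε hε1 hL fun j hj => ?_
  exact (hb j hj x (subset_closure hx)).trans ((le_abs_self _).trans
    (Finset.single_le_sum (f := fun j => |b j|) (fun _ _ => abs_nonneg _) hj))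

/-! ### Accumulation along rollouts -/

/-- Summing a one-step error along a rollout. -/
theorem IsRollout.abs_sub_le {P : Type*} {R : Set P} {S : P → P} {N : ℕ} {u : ℕ → P}
    (hu : IsRollout R S N u) {F : P → ℝ} {d : ℝ} (hF : ∀ v ∈ R, |F (S v) - F v| ≤ d) :
    ∀ n ≤ N, |F (u n) - F (u 0)| ≤ n * d := by
  intro n
  induction n with
  | zero => simp
  | succ n ih =>
    intro hn
    have h1 := ih (by omega)
    have h2 := hF (u n) (hu.2 n (by omega))
    rw [← hu.1 n (by omega)] at h2
    have h3 := _root_.abs_sub_le (F (u (n + 1))) (F (u n)) (F (u 0))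
    push_cast
    linarith

theorem mainTheorem1 {P : Type*} [NormedAddCommGroup P] [InnerProductSpace ℝ P] [CompleteSpace P]
    (J : P ≃L[ℝ] P) (hJ : IsSkewAdjoint J)
    (U R : Set P) (hU : IsOpen U) (hRc : IsCompact (closure R)) (hRU : closure R ⊆ U)
    (m : ℕ) (τ : ℝ) (hτ : 0 < τ)
    (H : P → ℝ) (hH : ContDiffOn ℝ ((m + 2 : ℕ) : ℕ∞) H U)
    (hflow : ∀ x ∈ U, ∃ y, FlowsTo U (hamVec J H) τ x y)
    (ε₁ : ℝ) (hε₁ : 0 < ε₁)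
    (Kε : ℝ → P → ℝ) (Kc : ℕ → P → ℝ) (hK : HasEpsExpansion U m ε₁ Kε Kc)
    (S : ℝ → P → P) (hS : ∀ ε ∈ Set.Ioo (0 : ℝ) ε₁, IsPerturbedFlowMap J U R τ H (Kε ε) (S ε))
    (hlog : ∃ Hc : ℕ → P → ℝ, HasHamiltonianLog J U R m τ ε₁ H S Hc) :
    ∃ Hc : ℕ → P → ℝ, (∀ j ∈ Finset.Icc 1 m, ContDiffOn ℝ 1 (Hc j) U) ∧
      ∃ C > 0, ∃ ε₀ ∈ Set.Ioc (0 : ℝ) ε₁,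
        (∀ ε ∈ Set.Ioo (0 : ℝ) ε₀,
          (∀ x ∈ R, |modifiedHam m H Hc ε x - H x| ≤ C * ε) ∧
          ∀ (N : ℕ) (u : ℕ → P), IsRollout R (S ε) N u → ∀ n ≤ N,
            |modifiedHam m H Hc ε (u n) - modifiedHam m H Hc ε (u 0)| ≤ C * n * ε ^ (m + 1) ∧
            |H (u n) - H (u 0)| ≤ C * ε + C * n * ε ^ (m + 1)) ∧
        ∀ c > 0, ∃ C' > 0, ∀ ε ∈ Set.Ioo (0 : ℝ) ε₀,
          ∀ (N : ℕ) (u : ℕ → P), IsRollout R (S ε) N u → ∀ n ≤ N,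
            (n : ℝ) ≤ c / ε ^ m → |H (u n) - H (u 0)| ≤ C' * ε := by
  obtain ⟨G, hlog⟩ := hlog
  have hH2 : ContDiffOn ℝ 2 H U := hH.of_le (WithTop.coe_le_coe.mpr (Nat.cast_le.mpr (Nat.le_add_left 2 m)))
  obtain ⟨δ, hδ, D, hD, hstep⟩ := exists_uniform_energy_error hJ hU hRc hRU hτ hH2 hflow hlog
  obtain ⟨B, hB, hclose⟩ := exists_abs_modifiedHam_sub_le hRc H
    (fun j hj => ((hlog.1 j hj).continuousOn.mono hRU))
  have hsmall : ∀ ε ∈ Ioo (0 : ℝ) (min ε₁ (min δ 1)),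
      ε ∈ Ioo (0 : ℝ) ε₁ ∧ ε < δ ∧ ε ≤ 1 := fun ε hε => by
    obtain ⟨h0, h1, h2, h3⟩ : 0 < ε ∧ ε < ε₁ ∧ ε < δ ∧ ε < 1 := by simpa using hε
    exact ⟨⟨h0, h1⟩, h2, h3.le⟩
  -- `2 * B` pays for exchanging `H` and the modified Hamiltonian at both `u n` and `u 0`, `D` for
  -- each step, and `1` for positivity.
  have hC : 0 < 2 * B + D + 1 := by positivity
  have henergy : ∀ ε ∈ Ioo (0 : ℝ) (min ε₁ (min δ 1)), ∀ (N : ℕ) (u : ℕ → P),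
      IsRollout R (S ε) N u → ∀ n ≤ N,
        |modifiedHam m H G ε (u n) - modifiedHam m H G ε (u 0)| ≤
          (2 * B + D + 1) * n * ε ^ (m + 1) ∧
        |H (u n) - H (u 0)| ≤ (2 * B + D + 1) * ε + (2 * B + D + 1) * n * ε ^ (m + 1) := by
    intro ε hε N u hu n hn
    obtain ⟨hε', hεδ, hε1⟩ := hsmall ε hε
    have h1 := hu.abs_sub_le (hstep ε hε' hεδ) n hn
    have h2 := hclose ε hε'.1.le hε1 (u n) (hu.2 n hn)
    have h3 := hclose ε hε'.1.le hε1 (u 0) (hu.2 0 (Nat.zero_le N))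
    have h4 : 0 ≤ (n : ℝ) * ε ^ (m + 1) := mul_nonneg n.cast_nonneg (pow_nonneg hε'.1.le _)
    have h5 : (n : ℝ) * (D * ε ^ (m + 1)) ≤ (2 * B + D + 1) * n * ε ^ (m + 1) := by nlinarith
    have h6 : 2 * (B * ε) ≤ (2 * B + D + 1) * ε := by nlinarith [hε'.1]
    rw [abs_le] at h1 h2 h3
    exact ⟨abs_le.mpr ⟨by linarith, by linarith⟩, abs_le.mpr ⟨by linarith, by linarith⟩⟩
  refine ⟨G, hlog.1, 2 * B + D + 1, hC, min ε₁ (min δ 1),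
    ⟨lt_min hε₁ (lt_min hδ one_pos), min_le_left _ _⟩,
    fun ε hε => ⟨fun x hx => ?_, henergy ε hε⟩, fun c hc => ?_⟩
  · obtain ⟨hε', -, hε1⟩ := hsmall ε hε
    refine (hclose ε hε'.1.le hε1 x hx).trans (mul_le_mul_of_nonneg_right ?_ hε'.1.le)
    linarith
  · refine ⟨(2 * B + D + 1) * (1 + c), by positivity, fun ε hε N u hu n hn hnc => ?_⟩
    have hε0 := (hsmall ε hε).1.1
    have h1 : (n : ℝ) * ε ^ m ≤ c := (le_div_iff₀ (pow_pos hε0 m)).mp hnc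
    calc |H (u n) - H (u 0)| ≤ _ := (henergy ε hε N u hu n hn).2
      _ = (2 * B + D + 1) * (1 + n * ε ^ m) * ε := by ring
      _ ≤ (2 * B + D + 1) * (1 + c) * ε := by gcongr
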